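/- Let $q$ be a prime power, let $n\ge 2$, and let $U\subsetneq \mathbb F_{q^n}$ be a proper $\mathbb F_q$-vector subspace of dimension $d_U\ge 1$. Let $G_U$ be the simple graph with vertex set $\mathbb F_{q^n}$ in which two distinct elements $a,b$ are adjacent if and only if $ab\in U$, and let $\omega(G_U)$ be its clique number. Suppose that $\omega(G_U)=q^t+r>d_U+2$ for integers $t>0$ and $0\le r\le d_U$, and let $n_U$ be the largest divisor of $n$ with $n_U\le d_U$. Then $1\le n_U<n$ and $$t\le \max\left\{n_U,\ \frac{7}{8}d_U+\frac{7}{32\log_2 q}\right\}.$$ In particular, the following hold: 1. if $n$ is prime, then $n_U=1$; 2. if $m$ is an integer with $1\le m\le 7$ and $d_U<\frac{n}{m}$, then $n_U\le \frac{n}{m+1}$ and $t<\frac{7n}{8m}+\frac{7}{32\log_2 q}$. -/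

import Mathlib

/-- The graph `G_U`: its vertices are the elements of the field `K` (regarded as an extension of
`F`), and distinct `a`, `b` are joined by an edge exactly when `a * b` lies in the `F`-subspace
`U`. -/
def mulSubspaceGraph {F K : Type*} [Field F] [Field K] [Algebra F K] (U : Submodule F K) :
    SimpleGraph K where
  Adj a b := a ≠ b ∧ a * b ∈ U
  symm := ⟨fun a b h => ⟨h.1.symm, by simpa only [mul_comm b a] using h.2⟩⟩
  loopless := ⟨fun _ h => h.1 rfl⟩

open Module Submodule

/-! A maximum clique is a subspace `W` with `W * W ⊆ U` plus at most `d` independent elements. Let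
`k = dim W`. If `3k > 2d`, the quotients of elements of `W` form a subfield of dimension at most `d`
containing a scaled copy of `W`, so `k ≤ n_U`; otherwise `k ≤ 2d/3 < 7d/8`. Finally `t ≤ k`, unless
`q ^ t ≤ 2d`, which again forces `t ≤ 7d/8`. The logarithmic term is only slack. -/

/-! ### Subspaces with few products, and subfields. -/

/-- The elements of `W` that multiplication by `x` sends into `W`. -/
def mulStable {F K : Type*} [Field F] [Field K] [Algebra F K] (W : Submodule F K) (x : K) :
    Submodule F K :=
  W ⊓ W.comap (LinearMap.mulLeft F x)

theorem mem_mulStable {F K : Type*} [Field F] [Field K] [Algebra F K] {W : Submodule F K}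
    {x w : K} : w ∈ mulStable W x ↔ w ∈ W ∧ x * w ∈ W := by
  simp [mulStable]

/-- If all products of elements of `W` lie in `U` then every quotient of elements of `W` sends a
large part of `W` into `W`. -/
theorem two_mul_finrank_le_add_finrank_mulStable {F K : Type*} [Field F] [Field K] [Algebra F K]
    [FiniteDimensional F K] {U W : Submodule F K} (hWU : ∀ a ∈ W, ∀ b ∈ W, a * b ∈ U)
    {x a : K} (ha : a ∈ W) (ha0 : a ≠ 0) (hxa : x * a ∈ W) :
    2 * finrank F W ≤ finrank F U + finrank F (mulStable W x) := by
  -- The map `(w, w') ↦ a (x w - w')` lands in `U`; its kernel is the graph of `w ↦ x w` on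
  -- `mulStable W x`.
  let f : (W × W) →ₗ[F] U := LinearMap.codRestrict U
    (((LinearMap.mulLeft F (x * a)).comp W.subtype).coprod
      (-((LinearMap.mulLeft F a).comp W.subtype))) (by
        rintro ⟨w, w'⟩
        simpa [sub_eq_add_neg, mul_assoc] using
          U.sub_mem (hWU _ hxa _ w.2) (hWU _ ha _ w'.2))
  have hf : ∀ p : LinearMap.ker f, x * (p.1.1 : K) = p.1.2 := by
    rintro ⟨⟨w, w'⟩, hp⟩
    have h := congrArg Subtype.val (LinearMap.mem_ker.1 hp)
    have h' : x * a * (w : K) - a * w' = 0 := by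
      simpa [f, sub_eq_add_neg, mul_assoc] using h
    apply mul_left_cancel₀ ha0
    linear_combination h'
  let g : LinearMap.ker f →ₗ[F] mulStable W x := LinearMap.codRestrict (mulStable W x)
    (W.subtype.comp ((LinearMap.fst F W W).comp (LinearMap.ker f).subtype)) (fun p =>
      mem_mulStable.2 ⟨p.1.1.2, by
        simp [hf p]⟩)
  have hg : Function.Injective g := by
    intro p p' h
    have h1 : (p.1.1 : K) = p'.1.1 := congrArg (fun z : mulStable W x => (z : K)) h
    have h2 : (p.1.2 : K) = p'.1.2 := by rw [← hf, ← hf, h1]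
    exact Subtype.ext (Prod.ext (Subtype.ext h1) (Subtype.ext h2))
  have h1 := f.finrank_range_add_finrank_ker
  have h2 := LinearMap.finrank_le_finrank_of_injective hg
  have h3 := (LinearMap.range f).finrank_le
  rw [finrank_prod] at h1
  omega

/-- Both `mulStable` subspaces have dimension at least `2 dim W - dim U > dim W / 2`, so they meet
nontrivially inside `W`. -/
theorem exists_common_mem_mulStable {F K : Type*} [Field F] [Field K] [Algebra F K]
    [FiniteDimensional F K] {U W : Submodule F K} (hWU : ∀ a ∈ W, ∀ b ∈ W, a * b ∈ U)
    (hdim : 2 * finrank F U < 3 * finrank F W) {x y : K}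
    (hx : ∃ a ∈ W, a ≠ 0 ∧ x * a ∈ W) (hy : ∃ a ∈ W, a ≠ 0 ∧ y * a ∈ W) :
    ∃ w ∈ W, w ≠ 0 ∧ x * w ∈ W ∧ y * w ∈ W := by
  obtain ⟨a, ha, ha0, hxa⟩ := hx
  obtain ⟨b, hb, hb0, hyb⟩ := hy
  have h1 := two_mul_finrank_le_add_finrank_mulStable hWU ha ha0 hxa
  have h2 := two_mul_finrank_le_add_finrank_mulStable hWU hb hb0 hyb
  have h3 := finrank_sup_add_finrank_inf_eq (mulStable W x) (mulStable W y)
  have h4 : finrank F ↥(mulStable W x ⊔ mulStable W y) ≤ finrank F W :=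
    finrank_mono (sup_le inf_le_left inf_le_left)
  have h5 : mulStable W x ⊓ mulStable W y ≠ ⊥ := by
    intro h
    rw [h, finrank_bot] at h3
    omega
  obtain ⟨w, hw, hw0⟩ := exists_mem_ne_zero_of_ne_bot h5
  obtain ⟨hwx, hwy⟩ := mem_inf.1 hw
  exact ⟨w, (mem_mulStable.1 hwx).1, hw0, (mem_mulStable.1 hwx).2, (mem_mulStable.1 hwy).2⟩

/-- The quotients of elements of a subspace of small doubling form a field. -/
theorem exists_intermediateField_quotients {F K : Type*} [Field F] [Field K] [Algebra F K]
    [FiniteDimensional F K] {U W : Submodule F K} (hWU : ∀ a ∈ W, ∀ b ∈ W, a * b ∈ U)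
    (hdim : 2 * finrank F U < 3 * finrank F W) :
    ∃ L : IntermediateField F K, ∀ x, x ∈ L ↔ ∃ a ∈ W, a ≠ 0 ∧ x * a ∈ W := by
  have hW : W ≠ ⊥ := by
    rintro rfl
    simp at hdim
  obtain ⟨e, he, he0⟩ := exists_mem_ne_zero_of_ne_bot hW
  have hinv : ∀ x : K, (∃ a ∈ W, a ≠ 0 ∧ x * a ∈ W) → ∃ a ∈ W, a ≠ 0 ∧ x⁻¹ * a ∈ W := by
    rintro x ⟨a, ha, ha0, hxa⟩
    by_cases hx : x = 0
    · exact ⟨a, ha, ha0, by simp [hx]⟩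
    · exact ⟨x * a, hxa, mul_ne_zero hx ha0, by rwa [inv_mul_cancel_left₀ hx]⟩
  have halg : ∀ c : F, ∃ a ∈ W, a ≠ 0 ∧ algebraMap F K c * a ∈ W := fun c =>
    ⟨e, he, he0, by rw [← Algebra.smul_def]; exact W.smul_mem c he⟩
  let S : Subalgebra F K :=
    { carrier := {x | ∃ a ∈ W, a ≠ 0 ∧ x * a ∈ W}
      mul_mem' := by
        intro x y hx hy
        by_cases hy0 : y = 0
        · exact ⟨e, he, he0, by simp [hy0]⟩
        -- For `w` common to `x` and `y⁻¹`, `(x * y) * (y⁻¹ * w) = x * w`.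
        obtain ⟨w, hw, hw0, h1, h2⟩ := exists_common_mem_mulStable hWU hdim hx (hinv y hy)
        refine ⟨y⁻¹ * w, h2, mul_ne_zero (inv_ne_zero hy0) hw0, ?_⟩
        rwa [mul_assoc, mul_inv_cancel_left₀ hy0]
      add_mem' := by
        intro x y hx hy
        obtain ⟨w, hw, hw0, h1, h2⟩ := exists_common_mem_mulStable hWU hdim hx hy
        exact ⟨w, hw, hw0, by rw [add_mul]; exact W.add_mem h1 h2⟩
      algebraMap_mem' := halg }
  exact ⟨{ S with inv_mem' := hinv }, fun x => Iff.rfl⟩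

/-- Double counting of pairs `(x, w)` with `x ∈ L`, `0 ≠ w ∈ W` and `x * w ∈ W`: each `x` has at
least `q ^ (2t - d) - 1` partners, each `w` at most `q ^ t`. -/
theorem finrank_quotients_le {F K : Type*} [Field F] [Field K] [Finite F] [Finite K]
    [Algebra F K] {U W : Submodule F K} (hWU : ∀ a ∈ W, ∀ b ∈ W, a * b ∈ U)
    (hdim : finrank F U < 2 * finrank F W) (L : Submodule F K)
    (hL : ∀ x ∈ L, ∃ a ∈ W, a ≠ 0 ∧ x * a ∈ W) :
    finrank F L ≤ finrank F U := by
  classical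
  have := Fintype.ofFinite K
  set q := Nat.card F with hq
  have hq2 : 2 ≤ q := Finite.one_lt_card
  set t := finrank F W
  set d := finrank F U
  have hcard : ∀ V : Submodule F K, (Finset.univ.filter (· ∈ V)).card = q ^ finrank F V := by
    intro V
    rw [← natCard_eq_pow_finrank (K := F), ← Fintype.card_subtype, Nat.card_eq_fintype_card]
  have herase : ∀ V : Submodule F K,
      ((Finset.univ.filter (· ∈ V)).erase 0).card = q ^ finrank F V - 1 := by
    intro V
    rw [Finset.card_erase_of_mem (by simp), hcard]
  have hcount := Finset.card_mul_le_card_mul (s := Finset.univ.filter (· ∈ L))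
    (t := (Finset.univ.filter (· ∈ W)).erase 0) (m := q ^ (2 * t - d) - 1) (n := q ^ t)
    (fun x w => x * w ∈ W) (by
      intro x hx
      obtain ⟨a, ha, ha0, hxa⟩ := hL x (by simpa using hx)
      have h := two_mul_finrank_le_add_finrank_mulStable hWU ha ha0 hxa
      calc q ^ (2 * t - d) - 1 ≤ q ^ finrank F (mulStable W x) - 1 :=
            Nat.sub_le_sub_right (Nat.pow_le_pow_right (by omega) (by omega)) 1
        _ = ((Finset.univ.filter (· ∈ mulStable W x)).erase 0).card := (herase _).symm
        _ ≤ _ := Finset.card_le_card fun w hw => by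
            simpa [mem_mulStable, Finset.bipartiteAbove, and_assoc] using hw) (by
      intro w hw
      have hw0 : w ≠ 0 := (Finset.mem_erase.1 hw).1
      calc _ ≤ (Finset.univ.filter (· ∈ W)).card :=
            Finset.card_le_card_of_injOn (fun x => x * w)
              (fun x hx => by
                simpa using (Finset.mem_filter.1 hx).2)
              (fun x _ y _ h => mul_right_cancel₀ hw0 h)
        _ = q ^ t := hcard W)
  rw [hcard, herase] at hcount
  by_contra! hlt
  have h1 : q ^ (d + 1) * (q ^ (2 * t - d) - 1) ≤ (q ^ t - 1) * q ^ t :=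
    (Nat.mul_le_mul_right _ (Nat.pow_le_pow_right (by omega) hlt)).trans hcount
  rw [Nat.mul_sub, Nat.sub_mul, ← pow_add, ← pow_add, one_mul, mul_one,
    show d + 1 + (2 * t - d) = t + t + 1 by omega, pow_succ q (t + t)] at h1
  have h2 : q ^ (d + 1) ≤ q ^ (t + t) := Nat.pow_le_pow_right (by omega) (by omega)
  have h3 : q ^ (t + t) * 2 ≤ q ^ (t + t) * q := Nat.mul_le_mul_left _ hq2
  have h4 : 0 < q ^ t := by positivity
  have h5 : 0 < q ^ (t + t) := by positivity
  omega

/-- A subspace `W` whose products lie in a space of dimension less than `3 / 2 * dim W` is, up to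
scaling, contained in a subfield of dimension at most that of the space of products. -/
theorem exists_dvd_finrank_of_mul_mem {F K : Type*} [Field F] [Field K] [Finite F] [Finite K]
    [Algebra F K] {U W : Submodule F K} (hWU : ∀ a ∈ W, ∀ b ∈ W, a * b ∈ U)
    (hdim : 2 * finrank F U < 3 * finrank F W) :
    ∃ e, e ∣ finrank F K ∧ e ≤ finrank F U ∧ finrank F W ≤ e := by
  obtain ⟨L, hL⟩ := exists_intermediateField_quotients hWU hdim
  refine ⟨finrank F L, ⟨_, (finrank_mul_finrank F L K).symm⟩, ?_, ?_⟩
  · exact finrank_quotients_le hWU (by omega) (Subalgebra.toSubmodule L.toSubalgebra)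
      fun x hx => (hL x).1 hx
  · have hW : W ≠ ⊥ := by
      rintro rfl
      simp at hdim
    obtain ⟨a, ha, ha0⟩ := exists_mem_ne_zero_of_ne_bot hW
    -- Division by a fixed nonzero `a ∈ W` embeds `W` in `L`.
    let f : W →ₗ[F] (Subalgebra.toSubmodule L.toSubalgebra) := LinearMap.codRestrict _
      ((LinearMap.mulRight F a⁻¹).comp W.subtype) (fun w =>
        (hL _).2 ⟨a, ha, ha0, by simp [ha0]⟩)
    refine LinearMap.finrank_le_finrank_of_injective (f := f) fun w w' h => ?_
    exact Subtype.ext (mul_right_cancel₀ (inv_ne_zero ha0) (congrArg Subtype.val h))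

/-! ### Structure of maximum cliques. -/

theorem card_le_finrank_of_mul_mem {F K : Type*} [Field F] [Field K] [Algebra F K]
    [FiniteDimensional F K] {U : Submodule F K} {S : Finset K}
    (hS : LinearIndepOn F id (S : Set K)) {x : K} (hx : x ≠ 0) (h : ∀ s ∈ S, x * s ∈ U) :
    S.card ≤ finrank F U := by
  let v : ↥(S : Set K) → U := fun s => ⟨x * s, h s s.2⟩
  have hv : LinearIndependent F v := by
    apply LinearIndependent.of_comp U.subtype
    exact LinearIndependent.map' (v := fun s : ↥(S : Set K) => (s : K)) hS
      (LinearMap.mulLeft F x) (LinearMap.ker_eq_bot.2 (mul_right_injective₀ hx))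
  simpa using hv.fintype_card_le_finrank

/-- A maximum clique with more than `dim U + 2` elements is the union of a subspace and at most
`dim U` further elements. -/
theorem exists_submodule_of_cliqueNum {F K : Type*} [Field F] [Field K] [Finite F] [Finite K]
    [Algebra F K] (U : Submodule F K)
    (hω : finrank F U + 2 < (mulSubspaceGraph U).cliqueNum) :
    ∃ (W : Submodule F K) (s : ℕ), (∀ a ∈ W, ∀ b ∈ W, a * b ∈ U) ∧ s ≤ finrank F U ∧
      (mulSubspaceGraph U).cliqueNum = Nat.card F ^ finrank F W + s := by
  classical
  have := Fintype.ofFinite K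
  obtain ⟨C, hC, hCcard⟩ := (mulSubspaceGraph U).exists_isNClique_cliqueNum
  have hmul : ∀ a ∈ C, ∀ b ∈ C, a ≠ b → a * b ∈ U := fun a ha b hb hab => (hC ha hb hab).2
  let B := C.filter fun x => x ∉ span F ((C : Set K) \ {x})
  let A := C.filter fun x => ¬ x ∉ span F ((C : Set K) \ {x})
  have hAB : B.card + A.card = C.card := Finset.card_filter_add_card_filter_not _
  have hBC : B ⊆ C := Finset.filter_subset _ _
  have hAC : A ⊆ C := Finset.filter_subset _ _
  -- Even `a * a ∈ U`, since `a` lies in the span of the other clique elements.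
  have hA : ∀ a ∈ A, ∀ y ∈ C, a * y ∈ U := by
    intro a ha y hy
    by_cases hay : a = y
    · subst hay
      have h : span F ((C : Set K) \ {a}) ≤ U.comap (LinearMap.mulLeft F a) :=
        span_le.2 fun z hz => hmul a (hAC ha) z hz.1 (Ne.symm hz.2)
      exact h (not_not.1 (Finset.mem_filter.1 ha).2)
    · exact hmul a (hAC ha) y hy hay
  let W := span F (A : Set K)
  have hWC : ∀ w ∈ W, ∀ y ∈ C, w * y ∈ U := fun w hw y hy =>
    (span_le.2 fun a ha => hA a ha y hy : W ≤ U.comap (LinearMap.mulRight F y)) hw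
  have hWW : ∀ a ∈ W, ∀ b ∈ W, a * b ∈ U := fun a ha b hb =>
    (span_le.2 fun c hc => hWC a ha c (hAC hc) : W ≤ U.comap (LinearMap.mulLeft F a)) hb
  have hBW : ∀ b ∈ B, b ∉ W := by
    intro b hb hbW
    have hsub : (A : Set K) ⊆ (C : Set K) \ {b} := by
      intro a ha
      refine ⟨hAC ha, ?_⟩
      rintro rfl
      exact (Finset.mem_filter.1 ha).2 (Finset.mem_filter.1 hb).2
    exact (Finset.mem_filter.1 hb).2 (span_mono hsub hbW)
  let D := Finset.univ.filter (· ∈ W)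
  have hDcard : D.card = Nat.card F ^ finrank F W := by
    rw [← natCard_eq_pow_finrank (K := F), ← Fintype.card_subtype, Nat.card_eq_fintype_card]
  have hdisj : Disjoint D B :=
    Finset.disjoint_left.2 fun x hx hxB => hBW x hxB (Finset.mem_filter.1 hx).2
  have hclique : (mulSubspaceGraph U).IsClique (D ∪ B : Finset K) := by
    intro x hx y hy hxy
    refine ⟨hxy, ?_⟩
    simp only [D, Finset.coe_union, Set.mem_union, Finset.mem_coe, Finset.mem_filter,
      Finset.mem_univ, true_and] at hx hy
    rcases hx with hx | hx <;> rcases hy with hy | hy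
    · exact hWW x hx y hy
    · exact hWC x hx y (hBC hy)
    · rw [mul_comm]
      exact hWC y hy x (hBC hx)
    · exact hmul x (hBC hx) y (hBC hy) hxy
  have hle := hclique.card_le_cliqueNum
  rw [Finset.card_union_of_disjoint hdisj, hDcard] at hle
  have hAD : A.card ≤ D.card :=
    Finset.card_le_card fun a ha => Finset.mem_filter.2 ⟨Finset.mem_univ _, subset_span ha⟩
  -- Replacing `A` by all of `W` keeps a clique, so maximality gives equality.
  have heq : (mulSubspaceGraph U).cliqueNum = Nat.card F ^ finrank F W + B.card := by omega
  have hB : LinearIndepOn F id (B : Set K) := by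
    rw [linearIndepOn_iff_notMem_span]
    intro b hb h
    rw [Set.image_id] at h
    exact (Finset.mem_filter.1 hb).2 (span_mono (Set.sdiff_subset_sdiff_left hBC) h)
  refine ⟨W, B.card, hWW, ?_, heq⟩
  by_cases hW : W = ⊥
  · exfalso
    rw [hW, finrank_bot, pow_zero] at heq
    -- If `W = ⊥`, multiplying the rest of `B` by `b` gives `B.card ≤ d + 1`, so the clique number
    -- is at most `d + 2`.
    obtain ⟨b, hb⟩ : B.Nonempty := Finset.card_pos.1 (by omega)
    have hb0 : b ≠ 0 := fun h => hBW b hb (h ▸ W.zero_mem)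
    have h := card_le_finrank_of_mul_mem (U := U) (S := B.erase b)
      (hB.mono (Finset.coe_subset.2 (Finset.erase_subset b B))) hb0 (fun s hs =>
        hmul b (hBC hb) s (hBC (Finset.mem_of_mem_erase hs)) (Finset.ne_of_mem_erase hs).symm)
    rw [Finset.card_erase_of_mem hb] at h
    omega
  · obtain ⟨w, hw, hw0⟩ := exists_mem_ne_zero_of_ne_bot hW
    exact card_le_finrank_of_mul_mem hB hw0 fun s hs => hWC w hw s (hBC hs)

/-! ### Comparison of exponents and the final bound. -/

theorem eight_mul_le_of_two_pow_le {t d : ℕ} (ht : 3 ≤ t) (h : 2 ^ t ≤ 2 * d) :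
    8 * t ≤ 7 * d := by
  have key : 8 * t * 2 ≤ 7 * 2 ^ t := by
    induction t, ht using Nat.le_induction with
    | base => norm_num
    | succ k hk ih =>
      have := ih ((Nat.pow_le_pow_right (by norm_num) k.le_succ).trans h)
      rw [pow_succ]
      omega
  omega

/-- Replacing a decomposition `q ^ k + s` by another one with a larger exponent forces the new
exponent to be small compared to `d`. -/
theorem eight_mul_le_of_pow_add_eq {q t r k s d : ℕ} (hq : 2 ≤ q) (h : q ^ t + r = q ^ k + s)
    (hs : s ≤ d) (hd : d + 2 < q ^ k + s) (hkt : k < t) : 8 * t ≤ 7 * d := by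
  have h1 : q ^ k * q ≤ q ^ t := by
    rw [← pow_succ]
    exact Nat.pow_le_pow_right (by omega) hkt
  have h2 : q ^ k * 2 ≤ q ^ k * q := Nat.mul_le_mul_left _ hq
  -- Here `q ^ t ≤ q ^ k + d` and `q ^ k ≤ q ^ t / 2`.
  have h3 : q ^ t ≤ 2 * d := by omega
  by_cases ht : 3 ≤ t
  · exact eight_mul_le_of_two_pow_le ht ((Nat.pow_le_pow_left hq t).trans h3)
  · obtain rfl | rfl : k = 0 ∨ k = 1 := by omega
    · simp only [pow_zero] at hd
      omega
    · obtain rfl : t = 2 := by omega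
      have h4 : q * q = q ^ 2 := by ring
      have h5 : q * 3 ≤ q * q := Nat.mul_le_mul_left _ (by simp only [pow_one] at hd; omega)
      simp only [pow_one] at hd
      omega

theorem mainTheorem7 {F K : Type*} [Field F] [Field K] [Finite F] [Finite K] [Algebra F K]
    (q n : ℕ) (hq : Nat.card F = q) (hn : Module.finrank F K = n) (hn2 : 2 ≤ n)
    (U : Submodule F K) (hU : U ≠ ⊤)
    (d : ℕ) (hd : Module.finrank F U = d) (hd1 : 1 ≤ d)
    (t r : ℕ) (hω : (mulSubspaceGraph U).cliqueNum = q ^ t + r)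
    (hω_gt : d + 2 < (mulSubspaceGraph U).cliqueNum) (ht : 0 < t) (hr : r ≤ d)
    (nU : ℕ) (hnU : IsGreatest {e : ℕ | e ∣ n ∧ e ≤ d} nU) :
    (1 ≤ nU ∧ nU < n) ∧
    (t : ℝ) ≤ max (nU : ℝ) (7 / 8 * (d : ℝ) + 7 / (32 * Real.logb 2 (q : ℝ))) ∧
    (n.Prime → nU = 1) ∧
    (∀ m : ℕ, 1 ≤ m → m ≤ 7 → (d : ℝ) < (n : ℝ) / (m : ℝ) →
      (nU : ℝ) ≤ (n : ℝ) / ((m : ℝ) + 1) ∧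
      (t : ℝ) < 7 * (n : ℝ) / (8 * (m : ℝ)) + 7 / (32 * Real.logb 2 (q : ℝ))) := by
  have hq2 : 2 ≤ q := hq ▸ Finite.one_lt_card
  have hdn : d < n := by
    rw [← hd, ← hn]
    exact Submodule.finrank_lt hU
  have hnU1 : 1 ≤ nU := hnU.2 ⟨one_dvd n, hd1⟩
  have hnUd : nU ≤ d := hnU.1.2
  have hc : 0 < 7 / (32 * Real.logb 2 (q : ℝ)) := by
    have : 0 < Real.logb 2 (q : ℝ) :=
      Real.logb_pos one_lt_two (by exact_mod_cast hq2)
    positivity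
  have hmain : t ≤ nU ∨ 8 * t ≤ 7 * d := by
    obtain ⟨W, s, hWU, hs, heq⟩ := exists_submodule_of_cliqueNum U (hd.symm ▸ hω_gt)
    rw [hq] at heq
    rw [hd] at hs
    by_cases hlt : finrank F W < t
    · exact Or.inr (eight_mul_le_of_pow_add_eq hq2 (hω.symm.trans heq) hs (heq ▸ hω_gt) hlt)
    by_cases hdim : 2 * finrank F U < 3 * finrank F W
    · obtain ⟨e, hen, hed, hWe⟩ := exists_dvd_finrank_of_mul_mem hWU hdim
      have : e ≤ nU := hnU.2 ⟨hn ▸ hen, hd ▸ hed⟩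
      omega
    · omega
  have hbound : (t : ℝ) ≤ max (nU : ℝ) (7 / 8 * (d : ℝ) + 7 / (32 * Real.logb 2 (q : ℝ))) := by
    rcases hmain with h | h
    · exact le_max_of_le_left (by exact_mod_cast h)
    · have h' : 8 * (t : ℝ) ≤ 7 * d := by exact_mod_cast h
      exact le_max_of_le_right (by linarith)
  refine ⟨⟨hnU1, hnUd.trans_lt hdn⟩, hbound, fun hp => ?_, fun m hm1 hm7 hdm => ?_⟩
  · exact ((Nat.dvd_prime hp).1 hnU.1.1).resolve_right (hnUd.trans_lt hdn).ne
  · have hm0 : (0 : ℝ) < m := by exact_mod_cast hm1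
    have hm7' : (m : ℝ) ≤ 7 := by exact_mod_cast hm7
    have hn0 : (0 : ℝ) < n := by exact_mod_cast (by omega : 0 < n)
    have hle : (nU : ℝ) ≤ (n : ℝ) / ((m : ℝ) + 1) := by
      obtain ⟨k, hk⟩ := hnU.1.1
      rw [lt_div_iff₀ hm0] at hdm
      have hdm' : d * m < n := by exact_mod_cast hdm
      have hmk : m < k := by
        by_contra! hkm
        have := Nat.mul_le_mul hnUd hkm
        omega
      rw [le_div_iff₀ (by positivity)]
      have : nU * (m + 1) ≤ n := hk ▸ Nat.mul_le_mul_left nU hmk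
      exact_mod_cast this
    refine ⟨hle, hbound.trans_lt (max_lt ?_ ?_)⟩
    · have : (n : ℝ) / ((m : ℝ) + 1) ≤ 7 * n / (8 * m) := by
        rw [div_le_div_iff₀ (by positivity) (by positivity)]
        nlinarith
      linarith
    · have : 7 * (n : ℝ) / (8 * m) = 7 / 8 * (n / m) := by ring
      rw [this]
      linarith
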